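/- Let $\mathcal S=\{0,1,\dots,2s\}$ with $s$ a positive integer, or $\mathcal S=\mathbb Z$ with $s\in\mathbb Z$, and put $\mathcal S_-=\{n\in\mathcal S: n<s\}$, $\mathcal S_+=\{n\in\mathcal S: n>s\}$. Let $X(t)$, $t\ge 0$, be a homogeneous continuous-time Markov chain on $\mathcal S$ whose paths are right-continuous with left limits in the discrete space $\mathcal S$ (finitely many jumps in bounded time), with transition probabilities $p_{k,n}(t)=\Pr\{X(t)=n\mid X(0)=k\}$ and finite rates $q_{k,n}=\frac{d}{dt}p_{k,n}(t)\big|_{t=0}$ (right derivative), where $q_{k,n}\ge 0$ for $k\ne n$, $q_{n,n}\le 0$ and $\sum_{n\in\mathcal S}q_{k,n}=0$ for all $k\in\mathcal S$. Assume: (1) (central symmetry) there are positive reals $x_n$, $n\in\mathcal S$, with $p_{2s-k,2s-n}(t)=\frac{x_n}{x_k}\,p_{k,n}(t)$ for all $k,n\in\mathcal S$ and $t\ge 0$; (2) $q_{i,j}=q_{j,i}=0$ for all $i\in\mathcal S_-$, $j\in\mathcal S_+$, and the sums $\sum_{i\in\mathcal S_-}q_{i,s}$, $\sum_{j\in\mathcal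 S_+}q_{j,s}$, $\sum_{i\in\mathcal S_-}q_{s,i}$, $\sum_{j\in\mathcal S_+}q_{s,j}$ are positive (possibly infinite); (3) the subchains on $\mathcal S_-$ and on $\mathcal S_+$ are irreducible: within each of these sets, any state is reached from any other by finitely many transitions of positive rate that stay in the set. Define the $s$-avoiding transition probabilities by $$p^{\langle s\rangle}_{k,n}(t)=\Pr\{X(t)=n,\ X(\vartheta)\ne s \text{ for all } \vartheta\in(0,t)\mid X(0)=k\}.$$ Then for every $t>0$ and all $k,n$ that lie both in $\mathcal S_-$ or both in $\mathcal S_+$, $$p^{\langle s\rangle}_{k,n}(t)=p_{k,n}(t)-\frac{x_k}{x_s}\,p_{2s-k,n}(t)=p_{k,n}(t)-\frac{x_s}{x_n}\,p_{k,2s-n}(t).$$ -/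

import Mathlib

open MeasureTheory Filter Topology
open scoped NNReal ENNReal

namespace SymmetricChain

noncomputable section

/-- A homogeneous continuous-time Markov chain with state space `S ⊆ ℤ` and time set `[0, ∞)`.
`P k` is the law `Pr{· | X(0) = k}`; only its values for `k ∈ S` matter. The chain is a jump
process: its paths are right-continuous with left limits for the discrete topology of the state
space, that is, they have finitely many jumps in bounded time. -/
structure IsMarkovChain {Ω : Type*} [MeasurableSpace Ω]
    (S : Set ℤ) (X : ℝ≥0 → Ω → ℤ) (P : ℤ → Measure Ω) : Prop where
  measurable : ∀ t, Measurable (X t)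
  mem_state : ∀ t ω, X t ω ∈ S
  isProbabilityMeasure : ∀ k ∈ S, IsProbabilityMeasure (P k)
  initial : ∀ k ∈ S, P k {ω | X 0 ω = k} = 1
  /-- The Markov property with stationary transition probabilities: for every event `A` of the
  past of `τ`, and all states `m`, `n`,
  `Pr_k(A, X(τ) = m, X(τ+t) = n) = Pr_k(A, X(τ) = m) Pr_m(X(t) = n)`. -/
  markov : ∀ k ∈ S, ∀ τ t : ℝ≥0, ∀ A : Set Ω,
    MeasurableSet[⨆ u : Set.Iic τ, MeasurableSpace.comap (X u) ⊤] A →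
    ∀ m ∈ S, ∀ n ∈ S,
      P k (A ∩ {ω | X τ ω = m} ∩ {ω | X (τ + t) ω = n})
        = P k (A ∩ {ω | X τ ω = m}) * P m {ω | X t ω = n}
  right_continuous : ∀ ω t, ContinuousWithinAt (fun u => X u ω) (Set.Ici t) t
  left_limits : ∀ ω t, ∃ m : ℤ, Tendsto (fun u => X u ω) (𝓝[<] t) (𝓝 m)

variable {Ω : Type*} [MeasurableSpace Ω]

/-- The transition probability `p_{k,n}(t) = Pr{X(t) = n | X(0) = k}`. -/
def transProb (X : ℝ≥0 → Ω → ℤ) (P : ℤ → Measure Ω) (k n : ℤ) (t : ℝ≥0) : ℝ :=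
  (P k).real {ω | X t ω = n}

/-- The `s`-avoiding transition probability
`Pr{X(t) = n, X(θ) ≠ s for all θ ∈ (0,t) | X(0) = k}`. -/
def avoidingProb (X : ℝ≥0 → Ω → ℤ) (P : ℤ → Measure Ω) (s k n : ℤ) (t : ℝ≥0) : ℝ :=
  (P k).real {ω | X t ω = n ∧ ∀ θ ∈ Set.Ioo 0 t, X θ ω ≠ s}

/-- `q` is the infinitesimal generator: `q_{k,n}` is the (right) derivative of `p_{k,n}` at `0`,
and the matrix is stable and conservative. -/
structure IsGenerator (S : Set ℤ) (X : ℝ≥0 → Ω → ℤ) (P : ℤ → Measure Ω) (q : ℤ → ℤ → ℝ) :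
    Prop where
  hasDeriv : ∀ k ∈ S, ∀ n ∈ S,
    HasDerivWithinAt (fun t : ℝ => transProb X P k n t.toNNReal) (q k n) (Set.Ici 0) 0
  off_diag_nonneg : ∀ k ∈ S, ∀ n ∈ S, k ≠ n → 0 ≤ q k n
  diag_nonpos : ∀ n ∈ S, q n n ≤ 0
  row_sum : ∀ k ∈ S, HasSum (fun n : S => q k n) 0

/-- Central symmetry about `N / 2` with weights `x`:
`p_{N-k,N-n}(t) = (x_n / x_k) p_{k,n}(t)`, with `x_n > 0`. -/
structure HasCentralSymmetry (S : Set ℤ) (X : ℝ≥0 → Ω → ℤ) (P : ℤ → Measure Ω)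
    (N : ℤ) (x : ℤ → ℝ) : Prop where
  pos : ∀ n ∈ S, 0 < x n
  symm : ∀ k ∈ S, ∀ n ∈ S, ∀ t : ℝ≥0,
    transProb X P (N - k) (N - n) t = x n / x k * transProb X P k n t

/-- The states below `s`. -/
def lowerStates (S : Set ℤ) (s : ℤ) : Set ℤ := {n ∈ S | n < s}

/-- The states above `s`. -/
def upperStates (S : Set ℤ) (s : ℤ) : Set ℤ := {n ∈ S | s < n}

/-- The state `s` separates `S_-` from `S_+`: there are no direct transitions between the two
sides, and positive total rates between `s` and each side. The sums have nonnegative terms and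
may be infinite, so they are taken in `[0, ∞]`. -/
structure Separates (S : Set ℤ) (q : ℤ → ℤ → ℝ) (s : ℤ) : Prop where
  up_zero : ∀ i ∈ lowerStates S s, ∀ j ∈ upperStates S s, q i j = 0
  down_zero : ∀ i ∈ lowerStates S s, ∀ j ∈ upperStates S s, q j i = 0
  lower_to : 0 < ∑' i : lowerStates S s, ENNReal.ofReal (q i s)
  upper_to : 0 < ∑' j : upperStates S s, ENNReal.ofReal (q j s)
  to_lower : 0 < ∑' i : lowerStates S s, ENNReal.ofReal (q s i)
  to_upper : 0 < ∑' j : upperStates S s, ENNReal.ofReal (q s j)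

/-- The subchain on `C` is irreducible: any state of `C` can be reached from any other one by
finitely many transitions of positive rate between states of `C`. -/
def IsIrreducibleOn (C : Set ℤ) (q : ℤ → ℤ → ℝ) : Prop :=
  ∀ i ∈ C, ∀ j ∈ C, Relation.ReflTransGen (fun a b => a ∈ C ∧ b ∈ C ∧ 0 < q a b) i j

end

end SymmetricChain

namespace SymmetricChain

/-! ### Càdlàg paths in a discrete space: exit times and jumps on grids. -/

section Paths

/-! This is a reflection argument. The states `k` and `2 * s - n` lie on opposite sides of `s`, and
jumps between the sides have rate zero, so a path from `k` to `2 * s - n` almost surely visits `s`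
(`ae_visits`). Once at `s`, which the symmetry fixes, the chain reaches `n` and `2 * s - n` with
probabilities in the ratio `x s : x n` (`measureReal_visits_reflect`). Hence the paths to `n`
through `s` have probability `x s / x n` times that of reaching `2 * s - n`; removing them gives the
second formula. The first visit is taken over finitely many times, so the Markov property at fixed
times suffices, and right-continuity justifies the limit.

The first formula follows by symmetry once `x n * x (2 * s - n) = x s * x s`. Applying the symmetry
twice shows that this product is constant along transitions of positive rate, and irreducibility
links `n` to `s`. -/

theorem eventually_eq_of_right_continuous {f : ℝ≥0 → ℤ} {t : ℝ≥0}
    (h : ContinuousWithinAt f (Set.Ici t) t) : ∀ᶠ u in 𝓝[≥] t, f u = f t := by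
  have := h.tendsto
  rwa [nhds_discrete, tendsto_pure] at this

theorem eventually_eq_of_left_limit {f : ℝ≥0 → ℤ} {t : ℝ≥0} {m : ℤ}
    (h : Tendsto f (𝓝[<] t) (𝓝 m)) : ∀ᶠ u in 𝓝[<] t, f u = m := by
  rwa [nhds_discrete, tendsto_pure] at h

/-- A right-continuous path with left limits that leaves a set `A` does so by a jump out of `A`
at its exit time. -/
theorem exists_jump_out {f : ℝ≥0 → ℤ}
    (hr : ∀ t, ContinuousWithinAt f (Set.Ici t) t)
    (hl : ∀ t, ∃ m : ℤ, Tendsto f (𝓝[<] t) (𝓝 m))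
    {A : Set ℤ} {t : ℝ≥0} (h0 : f 0 ∈ A) (ht : f t ∉ A) :
    ∃ τ, 0 < τ ∧ τ ≤ t ∧ f τ ∉ A ∧
      ∃ i ∈ A, i ∈ Set.range f ∧ Tendsto f (𝓝[<] τ) (𝓝 i) := by
  set B : Set ℝ≥0 := {u | f u ∉ A} with hB
  have hne : B.Nonempty := ⟨t, ht⟩
  have hbelow : ∀ u < sInf B, f u ∈ A := fun u hu => by
    by_contra h
    exact absurd (csInf_le (OrderBot.bddBelow B) h) (not_le.2 hu)
  -- The infimum is attained: otherwise right-continuity would keep `f` in `A` just after it, where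
  -- `B` has points.
  have hmem : f (sInf B) ∉ A := by
    intro h
    have hev := eventually_eq_of_right_continuous (hr (sInf B))
    obtain ⟨v, hv, hvs⟩ := (mem_nhdsGE_iff_exists_Ico_subset).1 hev
    obtain ⟨u, hu, huv⟩ := exists_lt_of_csInf_lt hne hv
    have : f u = f (sInf B) := hvs ⟨csInf_le (OrderBot.bddBelow B) hu, huv⟩
    exact hu (this ▸ h)
  have hpos : 0 < sInf B := by
    rcases eq_or_lt_of_le (zero_le (a := sInf B)) with h | h
    · rw [← h] at hmem
      exact absurd h0 hmem
    · exact h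
  obtain ⟨i, hi⟩ := hl (sInf B)
  have : (𝓝[<] (sInf B)).NeBot := nhdsLT_neBot_of_exists_lt ⟨0, hpos⟩
  obtain ⟨u, hu, hui⟩ :=
    ((eventually_eq_of_left_limit hi).and self_mem_nhdsWithin).exists
  exact ⟨sInf B, hpos, csInf_le (OrderBot.bddBelow B) ht, hmem, i, hu ▸ hbelow u hui,
    ⟨u, hu⟩, hi⟩

/-- A jump of a path from `i` to `j` at a time `τ ≤ t` is seen on every sufficiently fine
equidistant grid of `[0, t]`. -/
theorem eventually_exists_grid_jump {f : ℝ≥0 → ℤ} {t τ : ℝ≥0} {i : ℤ}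
    (hr : ContinuousWithinAt f (Set.Ici τ) τ) (hl : Tendsto f (𝓝[<] τ) (𝓝 i))
    (hτ : 0 < τ) (hτt : τ ≤ t) :
    ∀ᶠ N : ℕ in atTop, ∃ m < N + 1,
      f (m * (t / (N + 1 : ℕ))) = i ∧
        f (m * (t / (N + 1 : ℕ)) + t / (N + 1 : ℕ)) = f τ := by
  obtain ⟨a, ha, has⟩ := (mem_nhdsLT_iff_exists_Ioo_subset' hτ).1 (eventually_eq_of_left_limit hl)
  obtain ⟨b, hb, hbs⟩ := (mem_nhdsGE_iff_exists_Ico_subset).1 (eventually_eq_of_right_continuous hr)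
  have ht : 0 < t := hτ.trans_le hτt
  have hlim : Tendsto (fun N : ℕ => t / ((N + 1 : ℕ) : ℝ≥0)) atTop (𝓝 0) :=
    (tendsto_const_div_atTop_nhds_zero_nat t).comp (tendsto_add_atTop_nat 1)
  have ha' : 0 < τ - a := tsub_pos_of_lt ha
  have hb' : 0 < b - τ := tsub_pos_of_lt hb
  filter_upwards [hlim.eventually (gt_mem_nhds ha'), hlim.eventually (gt_mem_nhds hb')]
    with N hNa hNb
  set h : ℝ≥0 := t / ((N + 1 : ℕ) : ℝ≥0) with hh
  have hN : (0 : ℝ≥0) < ((N + 1 : ℕ) : ℝ≥0) := by positivity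
  have hpos : 0 < h := div_pos ht hN
  have hmul : ((N + 1 : ℕ) : ℝ≥0) * h = t := mul_div_cancel₀ t hN.ne'
  -- The least grid index at or after `τ` is `m + 1`. As the mesh is below `τ - a` and `b - τ`, both
  -- neighbouring grid points fall where `f` is constant.
  have hex : ∃ m : ℕ, τ ≤ m * h := ⟨N + 1, by rw [hmul]; exact hτt⟩
  classical
  have hm0 : Nat.find hex ≠ 0 := fun h0 => by
    have := Nat.find_spec hex
    rw [h0] at this
    simp at this
    exact hτ.ne' this
  obtain ⟨m, hm⟩ := Nat.exists_eq_succ_of_ne_zero hm0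
  have hup : τ ≤ m * h + h := by
    have := Nat.find_spec hex
    rw [hm] at this
    push_cast at this
    linarith
  have hlo : m * h < τ := not_le.1 (Nat.find_min hex (by omega))
  have hmN : m < N + 1 := by
    have : Nat.find hex ≤ N + 1 := Nat.find_min' hex (by rw [hmul]; exact hτt)
    omega
  refine ⟨m, hmN, has ⟨?_, hlo⟩, hbs ⟨hup, ?_⟩⟩
  · rw [lt_tsub_iff_right] at hNa
    have : h + a < m * h + h := hNa.trans_le hup
    linarith
  · rw [lt_tsub_iff_right] at hNb
    have : m * h + h < τ + h := by linarith
    exact this.trans (by linarith)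

end Paths

section Chain

variable {Ω : Type*} [MeasurableSpace Ω] {S : Set ℤ} {X : ℝ≥0 → Ω → ℤ} {P : ℤ → Measure Ω}

/-! ### Jumps of zero rate and forced visits to `s`. -/

theorem IsMarkovChain.measurableSet_eq (hX : IsMarkovChain S X P) (t : ℝ≥0) (n : ℤ) :
    MeasurableSet {ω | X t ω = n} :=
  hX.measurable t (MeasurableSet.singleton n)

theorem IsMarkovChain.ae_initial (hX : IsMarkovChain S X P) {k : ℤ} (hk : k ∈ S) :
    ∀ᵐ ω ∂P k, X 0 ω = k := by
  have := hX.isProbabilityMeasure k hk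
  rw [ae_iff]
  exact (prob_compl_eq_zero_iff (hX.measurableSet_eq 0 k)).2 (hX.initial k hk)

theorem IsMarkovChain.measure_two_times_le (hX : IsMarkovChain S X P) {k i j : ℤ} (hk : k ∈ S)
    (hi : i ∈ S) (hj : j ∈ S) (u h : ℝ≥0) :
    P k {ω | X u ω = i ∧ X (u + h) ω = j} ≤ ENNReal.ofReal (transProb X P i j h) := by
  have := hX.isProbabilityMeasure k hk
  have := hX.isProbabilityMeasure i hi
  have := hX.markov k hk u h Set.univ MeasurableSet.univ i hi j hj
  rw [Set.univ_inter] at this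
  rw [Set.ofPred_and, this, transProb, ofReal_measureReal]
  exact mul_le_of_le_one_left zero_le prob_le_one

/-- Jumps from `i` to `j` almost surely do not occur when the rate `q i j` vanishes. -/
theorem IsMarkovChain.measure_jump_eq_zero (hX : IsMarkovChain S X P) {q : ℤ → ℤ → ℝ}
    (hq : IsGenerator S X P q) {k i j : ℤ} (hk : k ∈ S) (hi : i ∈ S) (hj : j ∈ S) (hij : i ≠ j)
    (hqij : q i j = 0) (t : ℝ≥0) (ht : 0 < t) :
    P k {ω | ∃ τ, 0 < τ ∧ τ ≤ t ∧ Tendsto (fun u => X u ω) (𝓝[<] τ) (𝓝 i) ∧ X τ ω = j} = 0 := by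
  let h : ℕ → ℝ≥0 := fun N => t / ((N + 1 : ℕ) : ℝ≥0)
  let E : ℕ → Set Ω := fun N =>
    ⋃ m ∈ Finset.range (N + 1), {ω | X (m * h N) ω = i ∧ X (m * h N + h N) ω = j}
  have hE : ∀ N, P k (E N) ≤ ENNReal.ofReal ((N + 1 : ℕ) * transProb X P i j (h N)) := by
    intro N
    calc P k (E N)
        ≤ ∑ m ∈ Finset.range (N + 1), P k {ω | X (m * h N) ω = i ∧ X (m * h N + h N) ω = j} :=
          measure_biUnion_finset_le _ _
      _ ≤ ∑ _m ∈ Finset.range (N + 1), ENNReal.ofReal (transProb X P i j (h N)) :=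
          Finset.sum_le_sum fun m _ => hX.measure_two_times_le hk hi hj _ _
      _ = _ := by
          rw [Finset.sum_const, Finset.card_range, nsmul_eq_mul,
            ENNReal.ofReal_mul (Nat.cast_nonneg _), ENNReal.ofReal_natCast]
  have h00 : transProb X P i j 0 = 0 := by
    have : P i {ω | X 0 ω = j} = 0 := by
      refine measure_mono_null ?_ (hX.ae_initial hi)
      intro ω (hω : X 0 ω = j) (h' : X 0 ω = i)
      exact hij (h'.symm.trans hω)
    simp [transProb, measureReal_def, this]
  have hlim0 : Tendsto (fun N : ℕ => t / ((N + 1 : ℕ) : ℝ≥0)) atTop (𝓝 0) :=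
    (tendsto_const_div_atTop_nhds_zero_nat t).comp (tendsto_add_atTop_nat 1)
  have hhpos : ∀ N, 0 < h N := fun N => div_pos ht (by positivity)
  -- This is `t` times a difference quotient of `p_{i,j}` at `0`, so it tends to `t * q i j = 0`.
  have hslope : Tendsto (fun N => ((N + 1 : ℕ) : ℝ) * transProb X P i j (h N)) atTop (𝓝 0) := by
    have hd := hq.hasDeriv i hi j hj
    rw [hqij, hasDerivWithinAt_iff_tendsto_slope] at hd
    have hseq : Tendsto (fun N => ((h N : ℝ≥0) : ℝ)) atTop (𝓝[Set.Ici (0 : ℝ) \ {0}] 0) := by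
      refine tendsto_nhdsWithin_iff.2 ⟨?_, .of_forall fun N => ⟨(h N).2, ?_⟩⟩
      · exact NNReal.tendsto_coe.2 hlim0
      · have := (hhpos N).ne'
        simpa using this
    have h1 := (hd.comp hseq).const_mul (t : ℝ)
    rw [mul_zero] at h1
    refine h1.congr fun N => ?_
    have hN : ((N + 1 : ℕ) : ℝ) ≠ 0 := by positivity
    have ht' : (t : ℝ) ≠ 0 := by exact_mod_cast ht.ne'
    simp only [Function.comp, slope_def_field, Real.toNNReal_coe, Real.toNNReal_zero, h00, sub_zero]
    have : ((h N : ℝ≥0) : ℝ) = t / ((N + 1 : ℕ) : ℝ) := by simp [h]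
    rw [this]
    field_simp
  have hlim : Tendsto (fun N => P k (E N)) atTop (𝓝 0) := by
    have := ENNReal.tendsto_ofReal hslope
    rw [ENNReal.ofReal_zero] at this
    exact tendsto_of_tendsto_of_tendsto_of_le_of_le tendsto_const_nhds this
      (fun _ => zero_le) hE
  -- A jump lies in `E N` for all large `N`, and each tail intersection is null because `P k (E N)`
  -- tends to `0`.
  have hsub : {ω | ∃ τ, 0 < τ ∧ τ ≤ t ∧ Tendsto (fun u => X u ω) (𝓝[<] τ) (𝓝 i) ∧ X τ ω = j}
      ⊆ ⋃ M : ℕ, ⋂ N ≥ M, E N := by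
    rintro ω ⟨τ, hτ, hτt, hl, rfl⟩
    obtain ⟨M, hM⟩ := eventually_atTop.1
      (eventually_exists_grid_jump (hX.right_continuous ω τ) hl hτ hτt)
    simp only [Set.mem_iUnion, Set.mem_iInter]
    refine ⟨M, fun N hN => ?_⟩
    obtain ⟨m, hm, h1, h2⟩ := hM N hN
    simp only [E, Set.mem_iUnion, Finset.mem_range]
    exact ⟨m, hm, h1, h2⟩
  refine measure_mono_null hsub (measure_iUnion_null fun M => ?_)
  refine le_antisymm (ge_of_tendsto hlim ?_) zero_le
  filter_upwards [eventually_ge_atTop M] with N hN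
  exact measure_mono (Set.biInter_subset_of_mem hN)

/-- If no jumps lead from `A` to `S \ (A ∪ {s})`, a chain started in `A` and found outside
`A ∪ {s}` has almost surely visited `s` in between. -/
theorem IsMarkovChain.ae_visits (hX : IsMarkovChain S X P) {q : ℤ → ℤ → ℝ}
    (hq : IsGenerator S X P q) {A : Set ℤ} {s : ℤ}
    (hA : ∀ i ∈ S, i ∈ A → ∀ j ∈ S, j ∉ A → j ≠ s → q i j = 0)
    {k n : ℤ} (hk : k ∈ S) (hkA : k ∈ A) (hn : n ∉ A) (hns : n ≠ s)
    (t : ℝ≥0) (ht : 0 < t) :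
    ∀ᵐ ω ∂P k, X t ω = n → ∃ u ∈ Set.Ioo 0 t, X u ω = s := by
  have hjump : ∀ᵐ ω ∂P k, ∀ i j : ℤ, i ∈ S → i ∈ A → j ∈ S → j ∉ A → j ≠ s →
      ¬ ∃ τ, 0 < τ ∧ τ ≤ t ∧ Tendsto (fun u => X u ω) (𝓝[<] τ) (𝓝 i) ∧ X τ ω = j := by
    refine ae_all_iff.2 fun i => ae_all_iff.2 fun j => ?_
    simp only [eventually_imp_distrib_left]
    intro hi hiA hj hjA hjs
    rw [ae_iff]
    simp only [not_not]
    exact hX.measure_jump_eq_zero hq hk hi hj (fun h => hjA (h ▸ hiA)) (hA i hi hiA j hj hjA hjs)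
      t ht
  filter_upwards [hjump, hX.ae_initial hk] with ω hω h0 htn
  obtain ⟨τ, hτ, hτt, hτA, i, hiA, ⟨u, rfl⟩, hl⟩ :=
    exists_jump_out (f := fun u => X u ω) (hX.right_continuous ω) (hX.left_limits ω)
      (A := A) (t := t) (by simpa [h0] using hkA) (by simpa [htn] using hn)
  have hτs : X τ ω = s := by
    by_contra hne
    exact hω _ _ (hX.mem_state u ω) hiA (hX.mem_state τ ω) hτA hne ⟨τ, hτ, hτt, hl, rfl⟩
  refine ⟨τ, ⟨hτ, lt_of_le_of_ne hτt ?_⟩, hτs⟩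
  rintro rfl
  exact hns (htn.symm.trans hτs)

/-! ### First visits and reflection at `s`. -/

/-- First-visit decomposition along a finite set of times. -/
theorem IsMarkovChain.measureReal_exists_finset (hX : IsMarkovChain S X P) {k s n : ℤ}
    (hk : k ∈ S) (hs : s ∈ S) (hn : n ∈ S) {t : ℝ≥0} (F : Finset ℝ≥0) (hF : ∀ u ∈ F, u ≤ t) :
    (P k).real {ω | (∃ u ∈ F, X u ω = s) ∧ X t ω = n} =
      ∑ u ∈ F, (P k).real {ω | (∀ v ∈ F, v < u → X v ω ≠ s) ∧ X u ω = s} *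
        transProb X P s n (t - u) := by
  have := hX.isProbabilityMeasure k hk
  -- Only times strictly before `u` enter, so `A u` is an event of the past of `u`, and adding `X u
  -- ω = s` makes the pieces disjoint.
  let A : ℝ≥0 → Set Ω := fun u => {ω | ∀ v ∈ F, v < u → X v ω ≠ s}
  have hA : ∀ u, MeasurableSet[⨆ v : Set.Iic u, MeasurableSpace.comap (X v) ⊤] (A u) := by
    intro u
    have : A u = ⋂ v ∈ F, ⋂ _ : v < u, (X v) ⁻¹' {s}ᶜ := by
      ext ω
      simp [A]
    rw [this]
    refine Finset.measurableSet_biInter _ fun v _ => MeasurableSet.iInter fun hv => ?_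
    exact (le_iSup (fun v : Set.Iic u => MeasurableSpace.comap (X v) ⊤) ⟨v, hv.le⟩) _
      ⟨{s}ᶜ, trivial, rfl⟩
  have hA' : ∀ u, MeasurableSet (A u) := fun u =>
    (iSup_le fun v : Set.Iic u => (hX.measurable v).comap_le) _ (hA u)
  have hunion : {ω | (∃ u ∈ F, X u ω = s) ∧ X t ω = n} =
      ⋃ u ∈ F, A u ∩ {ω | X u ω = s} ∩ {ω | X t ω = n} := by
    ext ω
    simp only [Set.mem_ofPred_eq, Set.mem_iUnion, Set.mem_inter_iff, A, exists_prop]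
    constructor
    · rintro ⟨⟨u, hu, hus⟩, hωn⟩
      classical
      have hne : (F.filter fun v => X v ω = s).Nonempty := ⟨u, by simp [hu, hus]⟩
      obtain ⟨hm, hms⟩ := Finset.mem_filter.1 (Finset.min'_mem _ hne)
      refine ⟨_, hm, ⟨fun v hv hlt hvs => ?_, hms⟩, hωn⟩
      exact absurd (Finset.min'_le _ v (by simp [hv, hvs])) (not_le.2 hlt)
    · rintro ⟨u, hu, ⟨-, hus⟩, hωn⟩
      exact ⟨⟨u, hu, hus⟩, hωn⟩
  rw [hunion, measureReal_biUnion_finset]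
  · refine Finset.sum_congr rfl fun u hu => ?_
    have := hX.markov k hk u (t - u) (A u) (hA u) s hs n hn
    rw [add_tsub_cancel_of_le (hF u hu)] at this
    rw [measureReal_def, this, ENNReal.toReal_mul]
    rfl
  · intro u hu v hv huv
    refine Set.disjoint_left.2 ?_
    rintro ω ⟨⟨h1, h2⟩, -⟩ ⟨⟨h3, h4⟩, -⟩
    rcases lt_or_gt_of_ne huv with h | h
    · exact h3 u hu h h2
    · exact h1 v hv h h4
  · intro u _
    exact ((hA' u).inter (hX.measurableSet_eq u s)).inter (hX.measurableSet_eq t n)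

/-- By right-continuity a visit to `s` lasts for a short interval, which contains a member of the
dense sequence. -/
theorem IsMarkovChain.exists_mem_Ioo_iff (hX : IsMarkovChain S X P) {s : ℤ} {t : ℝ≥0} {ω : Ω} :
    (∃ u ∈ Set.Ioo 0 t, X u ω = s) ↔
      ∃ N, TopologicalSpace.denseSeq ℝ≥0 N ∈ Set.Ioo 0 t ∧
        X (TopologicalSpace.denseSeq ℝ≥0 N) ω = s := by
  constructor
  · rintro ⟨u, ⟨hu0, hut⟩, hus⟩
    obtain ⟨v, hv, hvs⟩ :=
      (mem_nhdsGE_iff_exists_Ico_subset).1 (eventually_eq_of_right_continuous (hX.right_continuous ω u))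
    obtain ⟨_, ⟨N, rfl⟩, hu, huv⟩ :=
      (TopologicalSpace.denseRange_denseSeq ℝ≥0).exists_between (lt_min hut (Set.mem_Ioi.1 hv))
    have : X _ ω = X u ω := hvs ⟨hu.le, huv.trans_le (min_le_right _ _)⟩
    exact ⟨N, ⟨hu0.trans hu, huv.trans_le (min_le_left _ _)⟩, this.trans hus⟩
  · rintro ⟨N, h1, h2⟩
    exact ⟨_, h1, h2⟩

theorem IsMarkovChain.measurableSet_visits (hX : IsMarkovChain S X P) (s : ℤ) (t : ℝ≥0) :
    MeasurableSet {ω | ∃ u ∈ Set.Ioo 0 t, X u ω = s} := by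
  have : {ω | ∃ u ∈ Set.Ioo 0 t, X u ω = s} =
      ⋃ N, {ω | TopologicalSpace.denseSeq ℝ≥0 N ∈ Set.Ioo 0 t ∧
        X (TopologicalSpace.denseSeq ℝ≥0 N) ω = s} := by
    ext ω
    simp only [Set.mem_iUnion, Set.mem_ofPred_eq, hX.exists_mem_Ioo_iff]
  rw [this]
  exact MeasurableSet.iUnion fun N => (MeasurableSet.const _).inter (hX.measurableSet_eq _ s)

/-- The finite subset of `(0, t)` formed by the first `N` members of a dense sequence. -/
noncomputable def denseTimes (t : ℝ≥0) (N : ℕ) : Finset ℝ≥0 :=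
  ((Finset.range N).image (TopologicalSpace.denseSeq ℝ≥0)).filter fun u => 0 < u ∧ u < t

theorem IsMarkovChain.tendsto_measureReal_visits (hX : IsMarkovChain S X P) {k : ℤ} (hk : k ∈ S)
    (s n : ℤ) (t : ℝ≥0) :
    Tendsto (fun N => (P k).real {ω | (∃ u ∈ denseTimes t N, X u ω = s) ∧ X t ω = n}) atTop
      (𝓝 ((P k).real {ω | (∃ u ∈ Set.Ioo 0 t, X u ω = s) ∧ X t ω = n})) := by
  have := hX.isProbabilityMeasure k hk
  have hunion : {ω | (∃ u ∈ Set.Ioo 0 t, X u ω = s) ∧ X t ω = n} =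
      ⋃ N, {ω | (∃ u ∈ denseTimes t N, X u ω = s) ∧ X t ω = n} := by
    ext ω
    simp only [Set.mem_ofPred_eq, Set.mem_iUnion, exists_and_right, hX.exists_mem_Ioo_iff]
    refine and_congr_left fun _ => ⟨?_, ?_⟩
    · rintro ⟨N, h1, h2⟩
      refine ⟨N + 1, _, ?_, h2⟩
      exact Finset.mem_filter.2 ⟨Finset.mem_image_of_mem _ (Finset.self_mem_range_succ N), h1⟩
    · rintro ⟨N, u, hu, h2⟩
      obtain ⟨hu1, hu2⟩ := Finset.mem_filter.1 hu
      obtain ⟨M, -, rfl⟩ := Finset.mem_image.1 hu1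
      exact ⟨M, hu2, h2⟩
  have hmono : Monotone fun N => {ω | (∃ u ∈ denseTimes t N, X u ω = s) ∧ X t ω = n} := by
    rintro N M hNM ω ⟨⟨u, hu, hus⟩, hωn⟩
    refine ⟨⟨u, ?_, hus⟩, hωn⟩
    exact Finset.filter_subset_filter _ (Finset.image_subset_image
      (Finset.range_subset_range.2 hNM)) hu
  rw [hunion]
  exact (ENNReal.tendsto_toReal (measure_ne_top _ _)).comp (tendsto_measure_iUnion_atTop hmono)

/-- The reflection principle: after a visit to the centre `s`, the states `n` and `2 s - n` are
reached with probabilities in the ratio `x s : x n`. -/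
theorem IsMarkovChain.measureReal_visits_reflect (hX : IsMarkovChain S X P) {x : ℤ → ℝ} {s : ℤ}
    (hsymm : HasCentralSymmetry S X P (2 * s) x) {k n : ℤ} (hk : k ∈ S) (hs : s ∈ S)
    (hn : n ∈ S) (hn' : 2 * s - n ∈ S) (t : ℝ≥0) :
    (P k).real {ω | (∃ u ∈ Set.Ioo 0 t, X u ω = s) ∧ X t ω = 2 * s - n} =
      x n / x s * (P k).real {ω | (∃ u ∈ Set.Ioo 0 t, X u ω = s) ∧ X t ω = n} := by
  refine tendsto_nhds_unique (hX.tendsto_measureReal_visits hk s (2 * s - n) t) ?_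
  refine ((hX.tendsto_measureReal_visits hk s n t).const_mul (x n / x s)).congr fun N => ?_
  have hF : ∀ u ∈ denseTimes t N, u ≤ t := fun u hu => (Finset.mem_filter.1 hu).2.2.le
  rw [hX.measureReal_exists_finset hk hs hn _ hF, hX.measureReal_exists_finset hk hs hn' _ hF,
    Finset.mul_sum]
  refine Finset.sum_congr rfl fun u _ => ?_
  have := hsymm.symm s hs n hn (t - u)
  rw [show 2 * s - s = s by ring] at this
  rw [this]
  ring

theorem IsMarkovChain.avoidingProb_eq_sub (hX : IsMarkovChain S X P) {k : ℤ} (hk : k ∈ S)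
    (s n : ℤ) (t : ℝ≥0) :
    avoidingProb X P s k n t = transProb X P k n t -
      (P k).real {ω | (∃ u ∈ Set.Ioo 0 t, X u ω = s) ∧ X t ω = n} := by
  have := hX.isProbabilityMeasure k hk
  have h := measureReal_inter_add_sdiff (μ := P k) (s := {ω | X t ω = n})
    (hX.measurableSet_visits s t)
  have h1 : {ω | X t ω = n} ∩ {ω | ∃ u ∈ Set.Ioo 0 t, X u ω = s} =
      {ω | (∃ u ∈ Set.Ioo 0 t, X u ω = s) ∧ X t ω = n} := by
    ext ω
    exact and_comm
  have h2 : {ω | X t ω = n} \ {ω | ∃ u ∈ Set.Ioo 0 t, X u ω = s} =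
      {ω | X t ω = n ∧ ∀ θ ∈ Set.Ioo 0 t, X θ ω ≠ s} := by
    ext ω
    simp
  rw [h1, h2] at h
  rw [avoidingProb, transProb]
  linarith

/-- The avoiding probability through reflection of the final state. -/
theorem IsMarkovChain.avoidingProb_eq_of_separates (hX : IsMarkovChain S X P) {q : ℤ → ℤ → ℝ}
    (hq : IsGenerator S X P q) {x : ℤ → ℝ} {s : ℤ}
    (hsymm : HasCentralSymmetry S X P (2 * s) x) {A : Set ℤ}
    (hA : ∀ i ∈ S, i ∈ A → ∀ j ∈ S, j ∉ A → j ≠ s → q i j = 0)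
    {k n : ℤ} (hk : k ∈ S) (hkA : k ∈ A) (hs : s ∈ S) (hn : n ∈ S) (hn' : 2 * s - n ∈ S)
    (hnA : 2 * s - n ∉ A) (hns : n ≠ s) (t : ℝ≥0) (ht : 0 < t) :
    avoidingProb X P s k n t =
      transProb X P k n t - x s / x n * transProb X P k (2 * s - n) t := by
  have hvis := hX.ae_visits hq hA hk hkA hnA (by omega) t ht
  have hp : transProb X P k (2 * s - n) t =
      (P k).real {ω | (∃ u ∈ Set.Ioo 0 t, X u ω = s) ∧ X t ω = 2 * s - n} := by
    refine measureReal_congr ?_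
    filter_upwards [hvis] with ω hω
    exact propext ⟨fun h => ⟨hω h, h⟩, fun h => h.2⟩
  rw [hX.avoidingProb_eq_sub hk, hp, hX.measureReal_visits_reflect hsymm hk hs hn hn']
  have h1 := (hsymm.pos n hn).ne'
  have h2 := (hsymm.pos s hs).ne'
  field_simp

/-! ### The weight identity. -/

theorem IsGenerator.exists_transProb_ne_zero {q : ℤ → ℤ → ℝ} (hq : IsGenerator S X P q)
    {a b : ℤ} (ha : a ∈ S) (hb : b ∈ S) (hab : q a b ≠ 0) : ∃ t, transProb X P a b t ≠ 0 := by
  by_contra! h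
  have hd := hq.hasDeriv a ha b hb
  simp only [h] at hd
  exact hab (UniqueDiffWithinAt.eq_deriv _ (uniqueDiffOn_Ici (0 : ℝ) 0 Set.self_mem_Ici) hd
    (hasDerivWithinAt_const _ _ _))

/-- The product of the weights of opposite states is the same for states joined by a transition
of positive rate. -/
theorem HasCentralSymmetry.mul_weight_eq {N : ℤ} {x : ℤ → ℝ}
    (hsymm : HasCentralSymmetry S X P N x) (hN : ∀ n ∈ S, N - n ∈ S) {q : ℤ → ℤ → ℝ}
    (hq : IsGenerator S X P q) {a b : ℤ} (ha : a ∈ S) (hb : b ∈ S) (hab : q a b ≠ 0) :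
    x a * x (N - a) = x b * x (N - b) := by
  obtain ⟨t, ht⟩ := hq.exists_transProb_ne_zero ha hb hab
  have h1 := hsymm.symm a ha b hb t
  have h2 := hsymm.symm (N - a) (hN a ha) (N - b) (hN b hb) t
  rw [sub_sub_cancel, sub_sub_cancel, h1] at h2
  have p1 := (hsymm.pos a ha).ne'
  have p2 := (hsymm.pos _ (hN a ha)).ne'
  field_simp at h2
  linarith

/-- Some `i` in `C` has positive rate into `s`, and a path from `n` to `i` carries the product of
weights along. -/
theorem HasCentralSymmetry.mul_weight_eq_of_irreducible {s : ℤ} {x : ℤ → ℝ}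
    (hsymm : HasCentralSymmetry S X P (2 * s) x) (hN : ∀ n ∈ S, 2 * s - n ∈ S)
    {q : ℤ → ℤ → ℝ} (hq : IsGenerator S X P q) (hs : s ∈ S) {C : Set ℤ} (hC : C ⊆ S)
    (hirr : IsIrreducibleOn C q) (hto : 0 < ∑' i : C, ENNReal.ofReal (q i s)) {n : ℤ}
    (hn : n ∈ C) : x n * x (2 * s - n) = x s * x s := by
  obtain ⟨i, hi⟩ : ∃ i : C, ENNReal.ofReal (q i s) ≠ 0 := by
    by_contra! h
    simp [h] at hto
  have hqi : q i s ≠ 0 := fun h => hi (by simp [h])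
  have his := hsymm.mul_weight_eq hN hq (hC i.2) hs hqi
  rw [show 2 * s - s = s by ring] at his
  rw [← his]
  have hpath := hirr n hn i i.2
  generalize (i : ℤ) = j at hpath
  induction hpath with
  | refl => rfl
  | tail _ hbc ih => exact ih.trans (hsymm.mul_weight_eq hN hq (hC hbc.1) (hC hbc.2.1) hbc.2.2.ne')

end Chain

end SymmetricChain

open SymmetricChain in
theorem theorem3p2 {Ω : Type*} [MeasurableSpace Ω]
    (S : Set ℤ) (s : ℤ)
    (hS : (0 < s ∧ S = Set.Icc 0 (2 * s)) ∨ S = Set.univ)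
    (X : ℝ≥0 → Ω → ℤ) (P : ℤ → Measure Ω)
    (hX : SymmetricChain.IsMarkovChain S X P)
    (q : ℤ → ℤ → ℝ) (hq : SymmetricChain.IsGenerator S X P q)
    (x : ℤ → ℝ) (hsymm : SymmetricChain.HasCentralSymmetry S X P (2 * s) x)
    (hsep : SymmetricChain.Separates S q s)
    (hlower : SymmetricChain.IsIrreducibleOn (SymmetricChain.lowerStates S s) q)
    (hupper : SymmetricChain.IsIrreducibleOn (SymmetricChain.upperStates S s) q)
    (t : ℝ≥0) (ht : 0 < t) (k n : ℤ)
    (hkn : (k ∈ SymmetricChain.lowerStates S s ∧ n ∈ SymmetricChain.lowerStates S s) ∨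
      (k ∈ SymmetricChain.upperStates S s ∧ n ∈ SymmetricChain.upperStates S s)) :
    SymmetricChain.avoidingProb X P s k n t
        = SymmetricChain.transProb X P k n t
          - x k / x s * SymmetricChain.transProb X P (2 * s - k) n t ∧
    SymmetricChain.avoidingProb X P s k n t
        = SymmetricChain.transProb X P k n t
          - x s / x n * SymmetricChain.transProb X P k (2 * s - n) t := by
  have hs : s ∈ S := by
    rcases hS with ⟨h, rfl⟩ | rfl
    · exact ⟨h.le, by omega⟩
    · trivial
  have hN : ∀ m ∈ S, 2 * s - m ∈ S := by
    rcases hS with ⟨h, rfl⟩ | rfl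
    · rintro m ⟨h1, h2⟩
      exact ⟨by omega, by omega⟩
    · exact fun _ _ => trivial
  have hk : k ∈ S := hkn.elim (fun h => h.1.1) fun h => h.1.1
  have hn : n ∈ S := hkn.elim (fun h => h.2.1) fun h => h.2.1
  have hweight : x n * x (2 * s - n) = x s * x s := by
    rcases hkn with ⟨-, h⟩ | ⟨-, h⟩
    · exact hsymm.mul_weight_eq_of_irreducible hN hq hs (fun _ h => h.1) hlower hsep.lower_to h
    · exact hsymm.mul_weight_eq_of_irreducible hN hq hs (fun _ h => h.1) hupper hsep.upper_to h
  have hsecond : avoidingProb X P s k n t =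
      transProb X P k n t - x s / x n * transProb X P k (2 * s - n) t := by
    rcases hkn with ⟨⟨-, hks⟩, -, hns⟩ | ⟨⟨-, hks⟩, -, hns⟩
    · refine hX.avoidingProb_eq_of_separates hq hsymm (A := Set.Iio s) ?_ hk hks hs hn (hN n hn)
        ?_ hns.ne t ht
      · intro i hi hiA j hj hjA hjs
        exact hsep.up_zero i ⟨hi, hiA⟩ j ⟨hj, lt_of_le_of_ne (not_lt.1 hjA) hjs.symm⟩
      · simp only [Set.mem_Iio]
        omega
    · refine hX.avoidingProb_eq_of_separates hq hsymm (A := Set.Ioi s) ?_ hk hks hs hn (hN n hn)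
        ?_ hns.ne' t ht
      · intro i hi hiA j hj hjA hjs
        exact hsep.down_zero j ⟨hj, lt_of_le_of_ne (not_lt.1 hjA) hjs⟩ i ⟨hi, hiA⟩
      · simp only [Set.mem_Ioi]
        omega
  refine ⟨?_, hsecond⟩
  -- Symmetry turns `p_{2s-k,n}` into a multiple of `p_{k,2s-n}`; `hratio` matches the coefficients.
  have h := hsymm.symm k hk (2 * s - n) (hN n hn) t
  rw [sub_sub_cancel] at h
  have p1 := (hsymm.pos k hk).ne'
  have p2 := (hsymm.pos n hn).ne'
  have p3 := (hsymm.pos s hs).ne'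
  have hratio : x s / x n = x (2 * s - n) / x s := by
    field_simp
    linarith
  rw [hsecond, h, hratio]
  field_simp
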